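/- Let $G=(X,Y,E)$ be a finite connected bipartite graph with both parts non-empty, and put $n_X=|X|$. A *red dominating set* is a set $D\subseteq X$ such that every $y\in Y$ has a neighbour in $D$; an *MCRD set* is a red dominating set of minimum cardinality. An ordering $y_1,\dots,y_{n_Y}$ of $Y$ is *convex* if the neighbours of each $x\in X$ are consecutive in it, and $G$ is *convex bipartite* if $Y$ has a convex ordering. Given a convex ordering, let $\mathrm{left}(x)$ and $\mathrm{right}(x)$ be the positions of the first and of the last neighbour of $x$. Orderings $x_1,\dots,x_{n_X}$ of $X$ and $y_1,\dots,y_{n_Y}$ of $Y$ form a *lex-convex ordering* of $G$ if the ordering of $Y$ is convex and the pairs $(\mathrm{left}(x_i),\mathrm{right}(x_i))$ are in non-decreasing lexicographic order. The *neighbourhood array* of $G$ is the array of the pairs $(\mathrm{left}(x_i),\mathrm{right}(x_i))$, $i=1,\dots,n_X$. A convex bipartite graph is always given by its neighbourhood array with respect to a lex-convex ordering. **Corollary.** The number of MCRD sets of an arbitrary convex bipartite graph can be computed in $\mathcal O(n_X+|E|)$ time: there are a program of the unit-cost random access machine (memory cells hold natural numbers; each assignment of a constant, copy, addition, truncated subtraction,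 indirect load, indirect store and comparison is one step) and a constant $C$ such that for every convex bipartite graph $G=(X,Y,E)$ and every lex-convex ordering of $G$, the program, started with the length $n_X$ and the neighbourhood array of $G$ in memory, halts after at most $C\,(n_X+|E|)$ steps and outputs the number of MCRD sets of $G$. -/

import Mathlib

/-! ### Red domination in bipartite graphs -/

/-- `D` is a red dominating set of the bipartite graph `G` with parts `X` and `Y`: it is a set of
vertices of `X` such that every vertex of `Y` has a neighbour in `D`. -/
def IsRedDominating {V : Type*} (G : SimpleGraph V) (X Y D : Finset V) : Prop :=
  D ⊆ X ∧ ∀ y ∈ Y, ∃ x ∈ D, G.Adj x y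

/-- The set of all minimum cardinality red dominating (MCRD) sets. -/
def mcrdSets {V : Type*} (G : SimpleGraph V) (X Y : Finset V) : Set (Finset V) :=
  {D | IsRedDominating G X Y D ∧ ∀ D', IsRedDominating G X Y D' → D.card ≤ D'.card}

/-! ### Lexicographic convex orderings

An ordering of `X` is an enumeration `x : Fin X.card ≃ X`, and similarly for `Y`. The vertices
`y 0, y 1, …` stand for `y₁, y₂, …`, so that `y j` has position `j + 1`. -/

/-- The ordering `y` of `Y` is convex: the neighbours of each vertex of `X` are consecutive. -/
def IsConvexOrdering {V : Type*} (G : SimpleGraph V) (X : Finset V) {Y : Finset V}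
    (y : Fin Y.card ≃ Y) : Prop :=
  ∀ v ∈ X, ∀ i j k : Fin Y.card, i ≤ j → j ≤ k →
    G.Adj v (y i) → G.Adj v (y k) → G.Adj v (y j)

/-- The positions in `Y` (counted from `1`) of the neighbours of `v`. -/
def neighborPositions {V : Type*} (G : SimpleGraph V) {Y : Finset V} (y : Fin Y.card ≃ Y)
    (v : V) : Set ℕ :=
  {p | ∃ j : Fin Y.card, G.Adj v (y j) ∧ p = (j : ℕ) + 1}

/-- The position of the leftmost neighbour of `v`. -/
noncomputable def leftPos {V : Type*} (G : SimpleGraph V) {Y : Finset V} (y : Fin Y.card ≃ Y)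
    (v : V) : ℕ :=
  sInf (neighborPositions G y v)

/-- The position of the rightmost neighbour of `v`. -/
noncomputable def rightPos {V : Type*} (G : SimpleGraph V) {Y : Finset V} (y : Fin Y.card ≃ Y)
    (v : V) : ℕ :=
  sSup (neighborPositions G y v)

/-- The orderings `x` of `X` and `y` of `Y` form a lexicographic convex ordering: `y` is convex,
and `x` is sorted by leftmost neighbour, then by rightmost neighbour. Vertices with the same
neighbourhood come in an arbitrary order. -/
def IsLexConvexOrdering {V : Type*} (G : SimpleGraph V) {X Y : Finset V}
    (x : Fin X.card ≃ X) (y : Fin Y.card ≃ Y) : Prop :=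
  IsConvexOrdering G X y ∧
    ∀ i j : Fin X.card, i < j →
      leftPos G y (x i) < leftPos G y (x j) ∨
        (leftPos G y (x i) = leftPos G y (x j) ∧ rightPos G y (x i) ≤ rightPos G y (x j))

/-! ### The unit-cost random access machine -/

namespace RAM

/-- A state: registers and memory cells, each holding a natural number. -/
structure State where
  reg : ℕ → ℕ
  mem : ℕ → ℕ

/-- Structured programs of a random access machine. A program mentions only finitely many
registers; memory is accessed indirectly. The only arithmetic is addition and (truncated)
subtraction, and the only tests are comparisons of two registers. -/
inductive Program where
  /-- do nothing -/
  | skip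
  /-- `reg d := c` for a fixed number `c` -/
  | const (d c : ℕ)
  /-- `reg d := reg a` -/
  | copy (d a : ℕ)
  /-- `reg d := reg a + reg b` -/
  | add (d a b : ℕ)
  /-- `reg d := reg a - reg b`, and `0` if `reg a < reg b` -/
  | sub (d a b : ℕ)
  /-- `reg d := mem (reg a)` -/
  | load (d a : ℕ)
  /-- `mem (reg a) := reg b` -/
  | store (a b : ℕ)
  /-- first `p`, then `q` -/
  | seq (p q : Program)
  /-- `if reg a < reg b then p else q` -/
  | ifLt (a b : ℕ) (p q : Program)
  /-- `while reg a < reg b do p` -/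
  | whileLt (a b : ℕ) (p : Program)

/-- `Exec p s t s'`: started in state `s`, the program `p` halts in state `s'` after exactly `t`
steps. Every elementary instruction is one step, and so is every evaluation of a test. -/
inductive Exec : Program → State → ℕ → State → Prop where
  | skip (s : State) : Exec .skip s 1 s
  | const (d c : ℕ) (s : State) :
      Exec (.const d c) s 1 ⟨Function.update s.reg d c, s.mem⟩
  | copy (d a : ℕ) (s : State) :
      Exec (.copy d a) s 1 ⟨Function.update s.reg d (s.reg a), s.mem⟩
  | add (d a b : ℕ) (s : State) :
      Exec (.add d a b) s 1 ⟨Function.update s.reg d (s.reg a + s.reg b), s.mem⟩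
  | sub (d a b : ℕ) (s : State) :
      Exec (.sub d a b) s 1 ⟨Function.update s.reg d (s.reg a - s.reg b), s.mem⟩
  | load (d a : ℕ) (s : State) :
      Exec (.load d a) s 1 ⟨Function.update s.reg d (s.mem (s.reg a)), s.mem⟩
  | store (a b : ℕ) (s : State) :
      Exec (.store a b) s 1 ⟨s.reg, Function.update s.mem (s.reg a) (s.reg b)⟩
  | seq {p q : Program} {s s' s'' : State} {t t' : ℕ} :
      Exec p s t s' → Exec q s' t' s'' → Exec (.seq p q) s (t + t') s''
  | ifLt_true {a b : ℕ} {p q : Program} {s s' : State} {t : ℕ} :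
      s.reg a < s.reg b → Exec p s t s' → Exec (.ifLt a b p q) s (t + 1) s'
  | ifLt_false {a b : ℕ} {p q : Program} {s s' : State} {t : ℕ} :
      ¬ s.reg a < s.reg b → Exec q s t s' → Exec (.ifLt a b p q) s (t + 1) s'
  | whileLt_true {a b : ℕ} {p : Program} {s s' s'' : State} {t t' : ℕ} :
      s.reg a < s.reg b → Exec p s t s' → Exec (.whileLt a b p) s' t' s'' →
        Exec (.whileLt a b p) s (t + t' + 1) s''
  | whileLt_false {a b : ℕ} {p : Program} {s : State} :
      ¬ s.reg a < s.reg b → Exec (.whileLt a b p) s 1 s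

/-- On the initial memory contents `m`, with all registers `0`, the program `p` halts after exactly
`t` steps with `out` in register `0`. -/
def Program.OutputsIn (p : Program) (m : ℕ → ℕ) (t out : ℕ) : Prop :=
  ∃ s : State, Exec p ⟨fun _ => 0, m⟩ t s ∧ s.reg 0 = out

end RAM

/-- The memory contents holding an array of `n` pairs `(l i, r i)`: the length `n` is in cell `0`,
the pair with index `i` is in the cells `2 * i + 1` and `2 * i + 2`, and all other cells are `0`. -/
def pairArray (n : ℕ) (l r : Fin n → ℕ) : ℕ → ℕ := fun a =>
  if a = 0 then n
  else if h : (a - 1) / 2 < n then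
    if a % 2 = 1 then l ⟨(a - 1) / 2, h⟩ else r ⟨(a - 1) / 2, h⟩
  else 0

/-- The neighbourhood array of the graph as initial memory contents: its entries are the pairs
`(leftPos, rightPos)` of the vertices of `X`, in the order `x`. -/
noncomputable def neighborhoodArray {V : Type*} (G : SimpleGraph V) {X Y : Finset V}
    (x : Fin X.card ≃ X) (y : Fin Y.card ≃ Y) : ℕ → ℕ :=
  pairArray X.card (fun i => leftPos G y (x i)) (fun i => rightPos G y (x i))

/-! ### Covers of an interval of positions by intervals -/

/-! In a convex ordering every vertex of `X` is an interval of positions, and red dominating sets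
are the covers of all positions (`isRedDominating_map_iff`). In a minimum cover no interval contains
another, so left and right ends increase together. Removing the first interval therefore leaves a
cover from the next left end `q'`, which lies at most one past the removed right end
(`CoversFrom.exists_erase`). Conversely, prepending an interval to such a cover gives a cover. Hence
chains count covers exactly at the minimum size (`card_coversFrom_eq_chainCount`), and there are
none below it (`exists_coversFrom_of_chainCount_ne_zero`); the answer is the lowest non-zero value
of `k ↦ chainCount l r m k 1`.

For each `q` only this lowest term is stored, as a pair on which sums and shifts cost constant time.
Intervals are treated from last to first; as left ends are sorted, the table entries that an
interval reads are already final (`RAM.wp_tableLoop`). It reads as many entries as the vertex has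
neighbours, so the total time is linear in `n_X + |E|` (`sum_rightPos_sub_leftPos_le`). -/

/-- `S` covers the positions `q, …, m`, using only intervals that start at `q` or later. -/
def CoversFrom {ι : Type*} (l r : ι → ℕ) (m q : ℕ) (S : Finset ι) : Prop :=
  (∀ p, q ≤ p → p ≤ m → ∃ i ∈ S, l i ≤ p ∧ p ≤ r i) ∧ ∀ i ∈ S, q ≤ l i

/-- The number of chains of `k` intervals leading from `q` to `m + 1`, where the interval `i` leads
from `l i` to each of `l i + 1, …, r i + 1`. -/
def chainCount {ι : Type*} [Fintype ι] (l r : ι → ℕ) (m : ℕ) : ℕ → ℕ → ℕ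
  | 0, q => if q = m + 1 then 1 else 0
  | k + 1, q => ∑ i with l i = q, ∑ q' ∈ Finset.Icc (q + 1) (r i + 1), chainCount l r m k q'

section Covers

variable {ι : Type*} {l r : ι → ℕ} {m q : ℕ} {S : Finset ι}

/-- A nested interval is redundant, so minimum covers contain none. -/
theorem CoversFrom.erase [DecidableEq ι] (hS : CoversFrom l r m q S) {i j : ι} (hi : i ∈ S)
    (hij : i ≠ j) (hl : l i ≤ l j) (hr : r j ≤ r i) : CoversFrom l r m q (S.erase j) := by
  refine ⟨fun p hq hm => ?_, fun a ha => hS.2 a (Finset.mem_of_mem_erase ha)⟩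
  obtain ⟨a, ha, h₁, h₂⟩ := hS.1 p hq hm
  by_cases haj : a = j
  · subst haj
    exact ⟨i, Finset.mem_erase.2 ⟨hij, hi⟩, by omega, by omega⟩
  · exact ⟨a, Finset.mem_erase.2 ⟨haj, ha⟩, h₁, h₂⟩

theorem CoversFrom.insert [DecidableEq ι] {q' : ℕ} (hS : CoversFrom l r m q' S) {i : ι}
    (hi : l i < q') (hr : q' ≤ r i + 1) : CoversFrom l r m (l i) (insert i S) := by
  refine ⟨fun p hq hm => ?_, fun a ha => ?_⟩
  · by_cases hp : p < q'
    · exact ⟨i, Finset.mem_insert_self _ _, hq, by omega⟩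
    · obtain ⟨a, ha, h⟩ := hS.1 p (by omega) hm
      exact ⟨a, Finset.mem_insert_of_mem ha, h⟩
  · rcases Finset.mem_insert.1 ha with rfl | ha
    · exact le_rfl
    · exact hi.le.trans (hS.2 a ha)

theorem CoversFrom.notMem {q' : ℕ} (hS : CoversFrom l r m q' S) {i : ι} (hi : l i < q') : i ∉ S :=
  fun h => absurd (hS.2 i h) (by omega)

/-- The smaller start must be covered by an interval beginning no later, which the other cover
forbids. Thus the rest of a chain determines `q'`, as injectivity of the bijection requires. -/
theorem CoversFrom.start_unique {q' : ℕ} (h : CoversFrom l r m q S) (h' : CoversFrom l r m q' S)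
    (hq : q ≤ m + 1) (hq' : q' ≤ m + 1) : q = q' := by
  by_contra hne
  rcases Nat.lt_or_gt_of_ne hne with hlt | hlt
  · obtain ⟨a, ha, h₁, -⟩ := h.1 q le_rfl (by omega)
    have := h'.2 a ha
    omega
  · obtain ⟨a, ha, h₁, -⟩ := h'.1 q' le_rfl (by omega)
    have := h.2 a ha
    omega

/-- A minimal cover consists of one interval starting at `q` and a cover of the rest. -/
theorem CoversFrom.exists_erase [DecidableEq ι] (hlr : ∀ i, l i ≤ r i) (hrm : ∀ i, r i ≤ m)
    (hq : q ≤ m) (hS : CoversFrom l r m q S)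
    (hmin : ∀ S', CoversFrom l r m q S' → S.card ≤ S'.card) :
    ∃ i ∈ S, l i = q ∧ ∃ q' ∈ Finset.Icc (q + 1) (r i + 1), CoversFrom l r m q' (S.erase i) := by
  have noerase : ∀ i ∈ S, ∀ j ∈ S, i ≠ j → l i ≤ l j → r i < r j := by
    intro i hi j hj hij hl
    by_contra hr
    have := hmin _ (hS.erase hi hij hl (by omega))
    have := Finset.card_erase_lt_of_mem hj
    omega
  obtain ⟨i, hi, h₁, h₂⟩ := hS.1 q le_rfl hq
  have hli : l i = q := le_antisymm h₁ (hS.2 i hi)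
  have hlt : ∀ j ∈ S.erase i, q < l j := by
    intro j hj
    obtain ⟨hji, hj⟩ := Finset.mem_erase.1 hj
    refine lt_of_le_of_ne (hS.2 j hj) fun h => ?_
    -- Two intervals starting at `q` would each have to end before the other.
    have h₁ := noerase i hi j hj (Ne.symm hji) (by omega)
    have h₂ := noerase j hj i hi hji (by omega)
    omega
  refine ⟨i, hi, hli, ?_⟩
  have hrest : ∀ p, r i < p → p ≤ m → ∃ j ∈ S.erase i, l j ≤ p ∧ p ≤ r j := by
    intro p hp hpm
    obtain ⟨j, hj, h₃, h₄⟩ := hS.1 p (by have := hlr i; omega) hpm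
    exact ⟨j, Finset.mem_erase.2 ⟨by rintro rfl; omega, hj⟩, h₃, h₄⟩
  rcases (S.erase i).eq_empty_or_nonempty with he | hne
  · have hri : r i = m := by
      by_contra h
      obtain ⟨j, hj, -⟩ := hrest (r i + 1) (by omega) (by have := hrm i; omega)
      simp [he] at hj
    -- With nothing left to cover, the chain ends at the sentinel position `m + 1`.
    refine ⟨m + 1, by simp [hri, hq], fun p h h' => by omega, ?_⟩
    simp [he]
  · obtain ⟨j, hj, hjmin⟩ := Finset.exists_min_image (S.erase i) l hne
    refine ⟨l j, Finset.mem_Icc.2 ⟨hlt j hj, ?_⟩, fun p hp hpm => ?_, hjmin⟩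
    · by_cases h : r i < m
      · obtain ⟨a, ha, h₃, -⟩ := hrest (r i + 1) (by omega) h
        exact (hjmin a ha).trans h₃
      · have := hlr j
        have := hrm j
        omega
    · by_cases h : r i < p
      · exact hrest p h hpm
      · obtain ⟨hji, hjS⟩ := Finset.mem_erase.1 hj
        -- Positions up to `r i` that were covered by `i` are now covered by `j`, which starts first
        -- among the rest and ends after `i`.
        have := noerase i hi j hjS (Ne.symm hji) (by have := hlt j hj; omega)
        exact ⟨j, hj, hp, by omega⟩

open Classical in
/-- Chains count the covers of a given size, provided that there is no smaller cover. -/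
theorem card_coversFrom_eq_chainCount [Fintype ι] (hlr : ∀ i, l i ≤ r i) (hrm : ∀ i, r i ≤ m)
    (k q : ℕ) (hq : q ≤ m + 1) (hmin : ∀ S, CoversFrom l r m q S → k ≤ S.card) :
    (Finset.univ.filter fun S : Finset ι => CoversFrom l r m q S ∧ S.card = k).card =
      chainCount l r m k q := by
  induction k generalizing q with
  | zero =>
    rw [chainCount]
    split_ifs with h
    · rw [Finset.card_eq_one]
      refine ⟨∅, ?_⟩
      ext S
      simp only [Finset.mem_filter, Finset.mem_univ, true_and, Finset.mem_singleton,
        Finset.card_eq_zero]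
      refine ⟨And.right, ?_⟩
      rintro rfl
      exact ⟨⟨fun p h₁ h₂ => by omega, by simp⟩, rfl⟩
    · rw [Finset.card_eq_zero, Finset.filter_eq_empty_iff]
      rintro S - ⟨hS, hc⟩
      obtain ⟨i, hi, -⟩ := hS.1 q le_rfl (by omega)
      rw [Finset.card_eq_zero] at hc
      simp [hc] at hi
  | succ k ih =>
    have hqm : q ≤ m := by
      by_contra h
      have := hmin ∅ ⟨fun p h₁ h₂ => by omega, by simp⟩
      simp at this
    have hsum : chainCount l r m (k + 1) q =
        ∑ i with l i = q, ∑ q' ∈ Finset.Icc (q + 1) (r i + 1),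
          (Finset.univ.filter fun S : Finset ι => CoversFrom l r m q' S ∧ S.card = k).card := by
      rw [chainCount]
      refine Finset.sum_congr rfl fun i hi => Finset.sum_congr rfl fun q' hq' => ?_
      obtain ⟨h₁, h₂⟩ := Finset.mem_Icc.1 hq'
      have hli : l i = q := (Finset.mem_filter.1 hi).2
      refine (ih q' (by have := hrm i; omega) fun S hS => ?_).symm
      -- A too small cover from `q'` would extend by `i` to a too small cover from `q`.
      have := hmin _ (hli ▸ hS.insert (by omega) h₂)
      rw [Finset.card_insert_of_notMem (hS.notMem (by omega))] at this
      omega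
    simp_rw [hsum, ← Finset.card_sigma]
    symm
    refine Finset.card_bij (fun a _ => insert a.1 a.2.2) ?_ ?_ ?_
    · rintro ⟨i, q', S⟩ h
      simp only [Finset.mem_sigma, Finset.mem_filter, Finset.mem_univ, true_and,
        Finset.mem_Icc] at h ⊢
      obtain ⟨rfl, ⟨h₁, h₂⟩, hS, hc⟩ := h
      exact ⟨hS.insert h₁ h₂, by rw [Finset.card_insert_of_notMem (hS.notMem h₁), hc]⟩
    · rintro ⟨i, q', S⟩ h ⟨i', q'', S'⟩ h' heq
      simp only [Finset.mem_sigma, Finset.mem_filter, Finset.mem_univ, true_and,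
        Finset.mem_Icc] at h h' heq
      obtain ⟨hi, ⟨h₁, h₂⟩, hS, -⟩ := h
      obtain ⟨hi', ⟨h₁', h₂'⟩, hS', -⟩ := h'
      -- The first interval is recognisable in the union: all others start after `q`.
      have hii : i = i' := by
        have := heq ▸ Finset.mem_insert_self i S
        rcases Finset.mem_insert.1 this with h | h
        · exact h
        · exact absurd h (hS'.notMem (by omega))
      subst hii
      have hSS : S = S' := by
        rw [← Finset.erase_insert (hS.notMem (i := i) (by omega)), heq,
          Finset.erase_insert (hS'.notMem (by omega))]
      subst hSS
      have := hrm i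
      have := hS.start_unique hS' (by omega) (by omega)
      subst this
      rfl
    · intro S hS
      simp only [Finset.mem_filter, Finset.mem_univ, true_and] at hS
      obtain ⟨i, hi, hli, q', hq', hc⟩ :=
        hS.1.exists_erase hlr hrm hqm fun S' hS' => hS.2 ▸ hmin S' hS'
      refine ⟨⟨i, q', S.erase i⟩, ?_, Finset.insert_erase hi⟩
      simp only [Finset.mem_sigma, Finset.mem_filter, Finset.mem_univ, true_and]
      refine ⟨hli, hq', hc, ?_⟩
      rw [Finset.card_erase_of_mem hi, hS.2]
      rfl

/-- Every chain yields a cover of the same size. -/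
theorem exists_coversFrom_of_chainCount_ne_zero [Fintype ι] (k q : ℕ)
    (h : chainCount l r m k q ≠ 0) : ∃ S, CoversFrom l r m q S ∧ S.card = k := by
  classical
  induction k generalizing q with
  | zero =>
    rw [chainCount] at h
    have hq : q = m + 1 := by by_contra h'; simp [h'] at h
    exact ⟨∅, ⟨fun p h₁ h₂ => by omega, by simp⟩, rfl⟩
  | succ k ih =>
    rw [chainCount] at h
    obtain ⟨i, hi, h⟩ := Finset.exists_ne_zero_of_sum_ne_zero h
    obtain ⟨q', hq', h⟩ := Finset.exists_ne_zero_of_sum_ne_zero h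
    obtain ⟨S, hS, hc⟩ := ih q' h
    obtain ⟨h₁, h₂⟩ := Finset.mem_Icc.1 hq'
    have hli : l i = q := (Finset.mem_filter.1 hi).2
    refine ⟨insert i S, hli ▸ hS.insert (by omega) h₂, ?_⟩
    rw [Finset.card_insert_of_notMem (hS.notMem (by omega)), hc]

end Covers

/-! ### Lowest terms -/

/-- The pair `(d, c)` records the lowest non-zero value of the sequence `N`: that value is `c`, at
the index `K - d`. If `d = 0`, then `N` vanishes below `K`. -/
def IsLowestTerm (K : ℕ) (N : ℕ → ℕ) (d c : ℕ) : Prop :=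
  d ≤ K ∧ (∀ k, k + d < K → N k = 0) ∧ (0 < d → N (K - d) = c ∧ 0 < c)

namespace IsLowestTerm

variable {K d c d' c' : ℕ} {N N' : ℕ → ℕ}

/-- The count is unconstrained when `d = 0`, so untouched zero cells already encode the zero
sequence. -/
theorem zero (K c : ℕ) : IsLowestTerm K (fun _ => 0) 0 c := by
  simp [IsLowestTerm]

theorem add_of_lt (h : IsLowestTerm K N d c) (h' : IsLowestTerm K N' d' c') (hd : d < d') :
    IsLowestTerm K (fun k => N k + N' k) d' c' := by
  obtain ⟨h₁, h₂, h₃⟩ := h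
  obtain ⟨h₁', h₂', h₃'⟩ := h'
  refine ⟨h₁', fun k hk => ?_, fun hd' => ?_⟩
  · simp only [h₂ k (by omega), h₂' k hk]
  · simpa [h₂ (K - d') (by omega)] using h₃' hd'

theorem add_of_gt (h : IsLowestTerm K N d c) (h' : IsLowestTerm K N' d' c') (hd : d' < d) :
    IsLowestTerm K (fun k => N k + N' k) d c := by
  simpa only [add_comm] using h'.add_of_lt h hd

theorem add_of_eq (h : IsLowestTerm K N d c) (h' : IsLowestTerm K N' d c') :
    IsLowestTerm K (fun k => N k + N' k) d (c + c') := by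
  obtain ⟨h₁, h₂, h₃⟩ := h
  obtain ⟨h₁', h₂', h₃'⟩ := h'
  refine ⟨h₁', fun k hk => ?_, fun hd' => ?_⟩
  · simp only [h₂ k hk, h₂' k hk]
  · have := h₃ hd'
    have := h₃' hd'
    simp only []
    omega

/-- Truncated subtraction fits the encoding: `d = 0` stays `0`, and a term pushed up to index `K` is
forgotten. -/
theorem shift (h : IsLowestTerm K N d c) (h₀ : N' 0 = 0) (hs : ∀ k, N' (k + 1) = N k) :
    IsLowestTerm K N' (d - 1) c := by
  obtain ⟨h₁, h₂, h₃⟩ := h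
  refine ⟨by omega, fun k hk => ?_, fun hd => ?_⟩
  · cases k with
    | zero => exact h₀
    | succ k => rw [hs]; exact h₂ k (by omega)
  · have : K - (d - 1) = K - d + 1 := by omega
    rw [this, hs]
    exact h₃ (by omega)

theorem eq_of_min (h : IsLowestTerm K N d c) {k : ℕ} (hk : k < K) (hN : N k ≠ 0)
    (hmin : ∀ j, j < k → N j = 0) : c = N k := by
  obtain ⟨h₁, h₂, h₃⟩ := h
  have hkd : ¬ k + d < K := fun h => hN (h₂ k h)
  obtain ⟨h₄, h₅⟩ := h₃ (by omega)
  have : K - d = k := by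
    by_contra hne
    have := hmin (K - d) (by omega)
    omega
  rw [← h₄, this]

end IsLowestTerm

/-! ### Reasoning about programs -/

namespace RAM

/-- Total correctness with a clock: started in state `s` at time `t₀`, the program `p` halts in a
state `s'` at a time `t'` such that `Q s' t'`. -/
def Program.Wp (p : Program) (Q : State → ℕ → Prop) (s : State) (t₀ : ℕ) : Prop :=
  ∃ t s', Exec p s t s' ∧ Q s' (t₀ + t)

/-- Sequential composition of a list of programs. -/
def Program.block : List Program → Program
  | [] => .skip
  | p :: ps => .seq p (block ps)

section Wp

variable {Q : State → ℕ → Prop} {p q : Program} {s : State} {t : ℕ} {a b d c : ℕ}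

theorem wp_skip (h : Q s (t + 1)) : Program.skip.Wp Q s t := ⟨1, s, .skip s, h⟩

theorem wp_const (h : Q ⟨Function.update s.reg d c, s.mem⟩ (t + 1)) :
    (Program.const d c).Wp Q s t := ⟨1, _, .const d c s, h⟩

theorem wp_copy (h : Q ⟨Function.update s.reg d (s.reg a), s.mem⟩ (t + 1)) :
    (Program.copy d a).Wp Q s t := ⟨1, _, .copy d a s, h⟩

theorem wp_add (h : Q ⟨Function.update s.reg d (s.reg a + s.reg b), s.mem⟩ (t + 1)) :
    (Program.add d a b).Wp Q s t := ⟨1, _, .add d a b s, h⟩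

theorem wp_sub (h : Q ⟨Function.update s.reg d (s.reg a - s.reg b), s.mem⟩ (t + 1)) :
    (Program.sub d a b).Wp Q s t := ⟨1, _, .sub d a b s, h⟩

theorem wp_load (h : Q ⟨Function.update s.reg d (s.mem (s.reg a)), s.mem⟩ (t + 1)) :
    (Program.load d a).Wp Q s t := ⟨1, _, .load d a s, h⟩

theorem wp_store (h : Q ⟨s.reg, Function.update s.mem (s.reg a) (s.reg b)⟩ (t + 1)) :
    (Program.store a b).Wp Q s t := ⟨1, _, .store a b s, h⟩

theorem wp_seq (h : p.Wp (q.Wp Q) s t) : (Program.seq p q).Wp Q s t := by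
  obtain ⟨u, s', he, u', s'', he', hq⟩ := h
  exact ⟨u + u', s'', .seq he he', by rwa [← add_assoc]⟩

theorem wp_block_cons {ps : List Program} (h : p.Wp ((Program.block ps).Wp Q) s t) :
    (Program.block (p :: ps)).Wp Q s t := wp_seq h

theorem wp_block_nil (h : Q s (t + 1)) : (Program.block []).Wp Q s t := wp_skip h

theorem wp_ifLt (h₁ : s.reg a < s.reg b → p.Wp Q s (t + 1))
    (h₂ : ¬ s.reg a < s.reg b → q.Wp Q s (t + 1)) : (Program.ifLt a b p q).Wp Q s t := by
  by_cases h : s.reg a < s.reg b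
  · obtain ⟨u, s', he, hq⟩ := h₁ h
    exact ⟨u + 1, s', .ifLt_true h he, by rwa [← add_assoc, add_right_comm]⟩
  · obtain ⟨u, s', he, hq⟩ := h₂ h
    exact ⟨u + 1, s', .ifLt_false h he, by rwa [← add_assoc, add_right_comm]⟩

/-- A loop whose invariant `I k` counts the remaining iterations. -/
theorem wp_whileLt (I : ℕ → State → ℕ → Prop)
    (hstep : ∀ k s t, I (k + 1) s t → s.reg a < s.reg b ∧ p.Wp (I k) s (t + 1))
    (hend : ∀ s t, I 0 s t → ¬ s.reg a < s.reg b ∧ Q s (t + 1)) (k : ℕ) (h : I k s t) :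
    (Program.whileLt a b p).Wp Q s t := by
  induction k generalizing s t with
  | zero =>
    obtain ⟨h₁, h₂⟩ := hend s t h
    exact ⟨1, s, .whileLt_false h₁, h₂⟩
  | succ k ih =>
    obtain ⟨h₁, u, s', he, hI⟩ := hstep k s t h
    obtain ⟨u', s'', he', hq⟩ := ih hI
    refine ⟨u + u' + 1, s'', .whileLt_true h₁ he he', ?_⟩
    convert hq using 1
    omega

end Wp

/-! ### The program -/

/-- Adds the lowest term in registers `12`, `13` to the one in registers `10`, `11`. -/
def addTerm : Program :=
  .ifLt 10 12 (.seq (.copy 10 12) (.copy 11 13)) (.ifLt 12 10 .skip (.add 11 11 13))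

/-- Computes the maximum of the right ends in register `4`. -/
def maxLoop : Program :=
  .whileLt 3 5 (.block [.load 6 3, .ifLt 4 6 (.copy 4 6) .skip, .add 3 3 14])

/-- Adds the table entries from address `reg 8` up to address `reg 9`. -/
def sumLoop : Program :=
  .whileLt 8 9 (.block [.load 12 8, .add 8 8 1, .load 13 8, .add 8 8 1, addTerm])

/-- Treats the intervals from the last to the first. -/
def tableLoop : Program :=
  .whileLt 15 3 (.block [
    .load 7 3, .sub 3 3 1, .load 6 3, .sub 3 3 1, .const 10 0, .const 11 0,
    .add 8 6 6, .add 8 8 5, .add 8 8 14,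
    .add 9 7 7, .add 9 9 5, .add 9 9 14, .add 9 9 14,
    sumLoop, .sub 10 10 1,
    .add 8 6 6, .add 8 8 5, .add 9 8 1, .load 12 8, .load 13 9,
    addTerm, .store 8 10, .store 9 11])

/-- Counts the covers of minimum cardinality. The table entry of `q`, the lowest term of
`k ↦ chainCount l r m k q`, is in the cells `2 * n + 1 + 2 * q` and `2 * n + 2 + 2 * q`. -/
def countCovers : Program :=
  .block [
    .const 1 1, .const 14 2, .load 2 0, .add 5 2 2, .add 5 5 1, .const 3 2,
    maxLoop,
    .add 8 4 4, .add 8 8 14, .add 8 8 5, .add 9 2 1, .store 8 9, .add 8 8 1, .store 8 1,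
    .sub 3 5 1,
    tableLoop,
    .add 8 5 14, .add 8 8 1, .load 0 8]

/-! ### Correctness and cost of the inner loops -/

/-- Natural numbers cannot cancel, so the lower index wins and ties add their counts. Every branch
takes exactly three steps. -/
theorem wp_addTerm {K : ℕ} {N N' : ℕ → ℕ} {Q : State → ℕ → Prop} {s : State} {t : ℕ}
    (h : IsLowestTerm K N (s.reg 10) (s.reg 11)) (h' : IsLowestTerm K N' (s.reg 12) (s.reg 13))
    (hQ : ∀ d c, IsLowestTerm K (fun k => N k + N' k) d c →
      Q ⟨Function.update (Function.update s.reg 10 d) 11 c, s.mem⟩ (t + 3)) :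
    addTerm.Wp Q s t := by
  refine wp_ifLt (fun hlt => wp_seq (wp_copy (wp_copy ?_))) fun hlt =>
    wp_ifLt (fun hgt => wp_skip ?_) fun hgt => wp_add ?_
  · exact hQ _ _ (h.add_of_lt h' hlt)
  · simpa using hQ _ _ (h.add_of_gt h' hgt)
  · have heq : s.reg 12 = s.reg 10 := by omega
    simpa using hQ _ _ (h.add_of_eq (heq ▸ h'))

/-- The input does not contain `|Y|`; it is recovered as the largest right end. -/
theorem wp_maxLoop {n m : ℕ} {l r : Fin n → ℕ} (hrm : ∀ i, r i ≤ m) (hm : ∃ i, r i = m)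
    {Q : State → ℕ → Prop} {s : State} {t : ℕ} (hmem : s.mem = pairArray n l r)
    (h₁ : s.reg 1 = 1) (h₂ : s.reg 2 = n) (h₃ : s.reg 3 = 2) (h₄ : s.reg 4 = 0)
    (h₅ : s.reg 5 = 2 * n + 1) (h₁₄ : s.reg 14 = 2) (h₁₅ : s.reg 15 = 0)
    (hQ : ∀ (s' : State) (t' : ℕ), s'.mem = pairArray n l r → s'.reg 1 = 1 → s'.reg 2 = n →
      s'.reg 4 = m → s'.reg 5 = 2 * n + 1 → s'.reg 14 = 2 → s'.reg 15 = 0 →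
      t' ≤ t + 6 * n + 1 → Q s' t') :
    maxLoop.Wp Q s t := by
  refine wp_whileLt (fun f s' t' => f ≤ n ∧ s'.mem = pairArray n l r ∧ s'.reg 1 = 1 ∧
    s'.reg 2 = n ∧ s'.reg 3 = 2 * (n - f) + 2 ∧ s'.reg 5 = 2 * n + 1 ∧ s'.reg 14 = 2 ∧
    s'.reg 15 = 0 ∧ s'.reg 4 ≤ m ∧ (∀ i : Fin n, (i : ℕ) < n - f → r i ≤ s'.reg 4) ∧
    t' + 6 * f ≤ t + 6 * n) ?_ ?_ n ?_
  · rintro f s t' ⟨hf, hmem, g₁, g₂, g₃, g₅, g₁₄, g₁₅, g₄, hmax, ht⟩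
    refine ⟨by omega, ?_⟩
    have hload : s.mem (2 * (n - (f + 1)) + 2) = r ⟨n - (f + 1), by omega⟩ := by
      have e : (2 * (n - (f + 1)) + 2 - 1) / 2 = n - (f + 1) := by omega
      simp only [hmem, pairArray, e]
      rw [if_neg (by omega), dif_pos (by omega), if_neg (by omega)]
    have hlast : ∀ i : Fin n, (i : ℕ) < n - f → (i : ℕ) < n - (f + 1) ∨
        r i = r ⟨n - (f + 1), by omega⟩ := by
      intro i hi
      by_cases h : (i : ℕ) < n - (f + 1)
      · exact .inl h
      · exact .inr (congrArg r (Fin.ext (by simp only; omega)))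
    have := hrm ⟨n - (f + 1), by omega⟩
    refine wp_block_cons (wp_load (wp_block_cons (wp_ifLt (fun h => wp_copy ?_)
      fun h => wp_skip ?_)))
    all_goals
      refine wp_block_cons (wp_add (wp_block_nil ?_))
      simp [g₃, hload] at h
      refine ⟨by omega, hmem, ?_⟩
      simp [hload, g₁, g₂, g₃, g₅, g₁₄, g₁₅]
      refine ⟨by omega, by omega, fun i hi => ?_, by omega⟩
      rcases hlast i hi with h' | h'
      · have := hmax i h'
        omega
      · omega
  · rintro s t' ⟨-, hmem, g₁, g₂, g₃, g₅, g₁₄, g₁₅, g₄, hmax, ht⟩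
    obtain ⟨i, hi⟩ := hm
    have := hmax i (by omega)
    exact ⟨by omega, hQ s _ hmem g₁ g₂ (by omega) g₅ g₁₄ g₁₅ (by omega)⟩
  · refine ⟨le_rfl, hmem, h₁, h₂, by omega, h₅, h₁₄, h₁₅, by omega, fun i hi => by omega, le_rfl⟩

/-- Each entry costs nine steps: the test, two loads, two increments, three for `addTerm` and the
closing `skip`. -/
theorem wp_sumLoop {K B b e : ℕ} {T : ℕ → ℕ → ℕ} {Q : State → ℕ → Prop} {s : State} {t : ℕ}
    (hbe : b ≤ e) (h₁ : s.reg 1 = 1) (h₈ : s.reg 8 = B + 2 * b) (h₉ : s.reg 9 = B + 2 * e)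
    (hT : ∀ q, b ≤ q → q < e →
      IsLowestTerm K (T q) (s.mem (B + 2 * q)) (s.mem (B + 2 * q + 1)))
    (h : IsLowestTerm K (fun _ => 0) (s.reg 10) (s.reg 11))
    (hQ : ∀ (s' : State) (t' : ℕ), s'.mem = s.mem → (∀ j < 8, s'.reg j = s.reg j) →
      (∀ j, 13 < j → s'.reg j = s.reg j) →
      IsLowestTerm K (fun k => ∑ q ∈ Finset.Ico b e, T q k) (s'.reg 10) (s'.reg 11) →
      t' ≤ t + 9 * (e - b) + 1 → Q s' t') :
    sumLoop.Wp Q s t := by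
  refine wp_whileLt (fun f s' t' => f ≤ e - b ∧ s'.mem = s.mem ∧ (∀ j < 8, s'.reg j = s.reg j) ∧
    (∀ j, 13 < j → s'.reg j = s.reg j) ∧ s'.reg 8 = B + 2 * (e - f) ∧ s'.reg 9 = B + 2 * e ∧
    IsLowestTerm K (fun k => ∑ q ∈ Finset.Ico b (e - f), T q k) (s'.reg 10) (s'.reg 11) ∧
    t' + 9 * f ≤ t + 9 * (e - b)) ?_ ?_ (e - b) ?_
  · rintro f s' t' ⟨hf, hmem, hlow, hhigh, g₈, g₉, hterm, ht⟩
    refine ⟨by omega, ?_⟩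
    have g₁ : s'.reg 1 = 1 := by rw [hlow 1 (by omega), h₁]
    refine wp_block_cons (wp_load (wp_block_cons (wp_add (wp_block_cons (wp_load
      (wp_block_cons (wp_add (wp_block_cons (wp_addTerm (K := K)
        (N := fun k => ∑ q ∈ Finset.Ico b (e - (f + 1)), T q k) (N' := T (e - (f + 1)))
        ?_ ?_ fun d c hdc => wp_block_nil ?_)))))))))
    · simpa using hterm
    · simpa [g₁, g₈, hmem] using hT (e - (f + 1)) (by omega) (by omega)
    · refine ⟨by omega, hmem, fun j hj => ?_, fun j hj => ?_, ?_, ?_, ?_, by omega⟩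
      · simp (disch := omega) [Function.update_of_ne, hlow j hj]
      · simp (disch := omega) [Function.update_of_ne, hhigh j hj]
      · simp [g₁, g₈]
        omega
      · simp [g₉]
      · have he : e - f = e - (f + 1) + 1 := by omega
        simpa [he, Finset.sum_Ico_succ_top (show b ≤ e - (f + 1) by omega)] using hdc
  · rintro s' t' ⟨-, hmem, hlow, hhigh, g₈, g₉, hterm, ht⟩
    exact ⟨by omega, hQ s' _ hmem hlow hhigh hterm (by omega)⟩
  · refine ⟨le_rfl, rfl, fun _ _ => rfl, fun _ _ => rfl, by omega, h₉, ?_, le_rfl⟩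
    simpa [show e - (e - b) = b by omega] using h

end RAM

/-! ### Partially processed tables -/

/-- The sequence `k ↦ chainCount l r m k q`, except that only the intervals from the one with
index `j` on may be the first of a chain. -/
def chainCountFrom {n : ℕ} (l r : Fin n → ℕ) (m j q : ℕ) : ℕ → ℕ
  | 0 => if q = m + 1 then 1 else 0
  | k + 1 => ∑ i : Fin n with l i = q ∧ j ≤ i, ∑ q' ∈ Finset.Icc (q + 1) (r i + 1),
      chainCount l r m k q'

section ChainCountFrom

variable {n : ℕ} {l r : Fin n → ℕ} {m j q : ℕ}

/-- An entry is final once every interval starting at `q` has been treated. -/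
theorem chainCountFrom_eq_chainCount (h : ∀ i : Fin n, l i = q → j ≤ i) (k : ℕ) :
    chainCountFrom l r m j q k = chainCount l r m k q := by
  cases k with
  | zero => rfl
  | succ k =>
    simp only [chainCountFrom, chainCount]
    congr 1
    ext i
    simpa using h i

theorem chainCountFrom_top (k : ℕ) (h : q = m + 1 → k ≠ 0) : chainCountFrom l r m n q k = 0 := by
  cases k with
  | zero => simpa [chainCountFrom] using h
  | succ k =>
    rw [chainCountFrom, Finset.filter_eq_empty_iff.2, Finset.sum_empty]
    intro i _ hi
    omega

theorem chainCountFrom_of_ne {i : Fin n} (h : l i ≠ q) (k : ℕ) :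
    chainCountFrom l r m i q k = chainCountFrom l r m (i + 1) q k := by
  cases k with
  | zero => rfl
  | succ k =>
    simp only [chainCountFrom]
    congr 1
    ext a
    simp only [Finset.mem_filter, Finset.mem_univ, true_and, and_congr_right_iff]
    intro ha
    have : (a : ℕ) ≠ i := fun h' => h (Fin.ext h' ▸ ha)
    omega

theorem chainCountFrom_self (i : Fin n) (k : ℕ) :
    chainCountFrom l r m i (l i) (k + 1) = chainCountFrom l r m (i + 1) (l i) (k + 1) +
      ∑ q' ∈ Finset.Ico (l i + 1) (r i + 2), chainCount l r m k q' := by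
  simp only [chainCountFrom]
  have : (Finset.univ.filter fun a : Fin n => l a = l i ∧ (i : ℕ) ≤ a) =
      insert i (Finset.univ.filter fun a : Fin n => l a = l i ∧ (i : ℕ) + 1 ≤ a) := by
    ext a
    simp only [Finset.mem_filter, Finset.mem_univ, true_and, Finset.mem_insert]
    by_cases h : a = i
    · simp [h]
    · have : (a : ℕ) ≠ i := fun h' => h (Fin.ext h')
      simp only [h, false_or, and_congr_right_iff]
      omega
  rw [this, Finset.sum_insert (by simp), add_comm]
  rfl

end ChainCountFrom

theorem sum_filter_lt_succ {n : ℕ} (f : Fin n → ℕ) (i : Fin n) :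
    ∑ a with a.val < i.val + 1, f a = f i + ∑ a with a.val < i.val, f a := by
  have : (Finset.univ.filter fun a : Fin n => a.val < i.val + 1) =
      insert i (Finset.univ.filter fun a : Fin n => a.val < i.val) := by
    ext a
    simp only [Finset.mem_filter, Finset.mem_univ, true_and, Finset.mem_insert, Fin.ext_iff]
    omega
  rw [this, Finset.sum_insert (by simp)]

/-! ### Correctness and cost of the whole program -/

namespace RAM

/-- The invariant is that after treating the intervals from index `f` on, the entries are the lowest
terms of `chainCountFrom l r m f`. The 27 steps per interval include the final test of the inner
scan. -/
theorem wp_tableLoop {n m K : ℕ} {l r : Fin n → ℕ} (hlr : ∀ i, l i ≤ r i)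
    (hl : ∀ i j, i < j → l i ≤ l j)
    {Q : State → ℕ → Prop} {s : State} {t : ℕ}
    (hmem : ∀ a < 2 * n + 1, s.mem a = pairArray n l r a)
    (h₁ : s.reg 1 = 1) (h₃ : s.reg 3 = 2 * n) (h₅ : s.reg 5 = 2 * n + 1) (h₁₄ : s.reg 14 = 2)
    (h₁₅ : s.reg 15 = 0)
    (hT : ∀ q, IsLowestTerm K (chainCountFrom l r m n q) (s.mem (2 * n + 1 + 2 * q))
      (s.mem (2 * n + 1 + 2 * q + 1)))
    (hQ : ∀ (s' : State) (t' : ℕ), s'.reg 1 = 1 → s'.reg 5 = 2 * n + 1 → s'.reg 14 = 2 →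
      (∀ q, IsLowestTerm K (fun k => chainCount l r m k q) (s'.mem (2 * n + 1 + 2 * q))
        (s'.mem (2 * n + 1 + 2 * q + 1))) →
      t' ≤ t + (∑ i, (27 + 9 * (r i + 1 - l i))) + 1 → Q s' t') :
    tableLoop.Wp Q s t := by
  refine wp_whileLt (fun f s' t' => f ≤ n ∧ (∀ a < 2 * n + 1, s'.mem a = pairArray n l r a) ∧
    s'.reg 1 = 1 ∧ s'.reg 3 = 2 * f ∧ s'.reg 5 = 2 * n + 1 ∧ s'.reg 14 = 2 ∧ s'.reg 15 = 0 ∧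
    (∀ q, IsLowestTerm K (chainCountFrom l r m f q) (s'.mem (2 * n + 1 + 2 * q))
      (s'.mem (2 * n + 1 + 2 * q + 1))) ∧
    t' + (∑ i : Fin n with i.val < f, (27 + 9 * (r i + 1 - l i))) ≤
      t + ∑ i, (27 + 9 * (r i + 1 - l i))) ?_ ?_ n ?_
  · rintro f s t' ⟨hf, hmem, g₁, g₃, g₅, g₁₄, g₁₅, hT, ht⟩
    refine ⟨by omega, ?_⟩
    obtain ⟨i, rfl⟩ : ∃ i : Fin n, (i : ℕ) = f := ⟨⟨f, hf⟩, rfl⟩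
    have hr : s.mem (2 * (i + 1)) = r i := by
      have e : (2 * ((i : ℕ) + 1) - 1) / 2 = i := by omega
      rw [hmem _ (by omega)]
      simp only [pairArray, e]
      rw [if_neg (by omega), dif_pos (by omega), if_neg (by omega)]
    have hl' : s.mem (2 * (i + 1) - 1) = l i := by
      have e : (2 * ((i : ℕ) + 1) - 1 - 1) / 2 = i := by omega
      rw [hmem _ (by omega)]
      simp only [pairArray, e]
      rw [if_neg (by omega), dif_pos (by omega), if_pos (by omega)]
    have hsum := sum_filter_lt_succ (fun a => 27 + 9 * (r a + 1 - l a)) i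
    have hli := hlr i
    refine wp_block_cons (wp_load (wp_block_cons (wp_sub (wp_block_cons (wp_load
      (wp_block_cons (wp_sub (wp_block_cons (wp_const (wp_block_cons (wp_const (wp_block_cons
      (wp_add (wp_block_cons (wp_add (wp_block_cons (wp_add (wp_block_cons (wp_add (wp_block_cons
      (wp_add (wp_block_cons (wp_add (wp_block_cons (wp_add (wp_block_cons (wp_sumLoop (K := K)
      (B := 2 * n + 1) (b := l i + 1) (e := r i + 2) (T := fun q k => chainCount l r m k q)
      (by omega) ?_ ?_ ?_ ?_ ?_ ?_)))))))))))))))))))))))))))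
    · simp [g₁]
    · simp [g₁, g₃, g₅, g₁₄, hl']
      omega
    · simp [g₁, g₃, g₅, g₁₄, hr]
      omega
    · intro q hq _
      have := hT q
      convert this using 1
      funext k
      -- Here sortedness enters: an interval starting at `q > l i` comes after `i`, so the scanned
      -- entry is final.
      refine (chainCountFrom_eq_chainCount (fun a ha => ?_) k).symm
      by_contra hlt
      rcases Nat.lt_or_ge a i with h | h
      · have := hl a i h
        omega
      · have : a = i := Fin.ext (by omega)
        subst this
        omega
    · simpa using IsLowestTerm.zero K 0
    · intro s' u hmem' hlow hhigh hterm hu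
      have k₁ := hlow 1 (by norm_num)
      have k₃ := hlow 3 (by norm_num)
      have k₅ := hlow 5 (by norm_num)
      have k₆ := hlow 6 (by norm_num)
      have k₁₄ := hhigh 14 (by norm_num)
      have k₁₅ := hhigh 15 (by norm_num)
      simp [g₁, g₃, g₅, g₁₄, g₁₅, hl'] at k₁ k₃ k₅ k₆ k₁₄ k₁₅ hmem'
      have haddr : l i + l i + (2 * n + 1) = 2 * n + 1 + 2 * l i := by omega
      -- Decrementing `d` raises chain lengths by one, for the interval `i` itself; hence the value
      -- `0` at length `0`.
      refine wp_block_cons (wp_sub (wp_block_cons (wp_add (wp_block_cons (wp_add (wp_block_cons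
        (wp_add (wp_block_cons (wp_load (wp_block_cons (wp_load (wp_block_cons (wp_addTerm (K := K)
        (N := fun k => match k with
          | 0 => 0
          | k + 1 => ∑ q ∈ Finset.Ico (l i + 1) (r i + 2), chainCount l r m k q)
        (N' := chainCountFrom l r m (i + 1) (l i))
        ?_ ?_ fun d c hdc => ?_)))))))))))))
      · simpa [k₁] using hterm.shift (N' := fun k => match k with
          | 0 => 0
          | k + 1 => ∑ q ∈ Finset.Ico (l i + 1) (r i + 2), chainCount l r m k q) rfl fun _ => rfl
      · simpa [k₁, k₅, k₆, hmem', haddr] using hT (l i)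
      · refine wp_block_cons (wp_store (wp_block_cons (wp_store (wp_block_nil ?_))))
        simp only [Function.update_of_ne, Function.update_self, ne_eq,
          Nat.reduceEqDiff, not_false_eq_true, k₁, k₃, k₅, k₆, k₁₄, k₁₅, hmem', haddr,
          OfNat.one_ne_ofNat]
        refine ⟨by omega, fun a ha => ?_, trivial, by omega, trivial, trivial, trivial,
          fun q => ?_, by omega⟩
        · rw [Function.update_of_ne (by omega), Function.update_of_ne (by omega), hmem a ha]
        · by_cases hq : q = l i
          · subst hq
            rw [Function.update_self, Function.update_of_ne (by omega), Function.update_self]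
            convert hdc using 1
            funext k
            cases k with
            | zero => simp [chainCountFrom]
            | succ k => rw [chainCountFrom_self, add_comm]
          · rw [Function.update_of_ne (by omega), Function.update_of_ne (by omega),
              Function.update_of_ne (by omega), Function.update_of_ne (by omega)]
            convert hT q using 1
            funext k
            exact chainCountFrom_of_ne (Ne.symm hq) k
  · rintro s t' ⟨-, hmem, g₁, g₃, g₅, g₁₄, g₁₅, hT, ht⟩
    refine ⟨by omega, hQ s _ g₁ g₅ g₁₄ (fun q => ?_) (by omega)⟩
    convert hT q using 1
    funext k
    exact (chainCountFrom_eq_chainCount (fun _ _ => Nat.zero_le _) k).symm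
  · refine ⟨le_rfl, hmem, h₁, h₃, h₅, h₁₄, h₁₅, hT, ?_⟩
    simp

/-- The program outputs the lowest non-zero value of `k ↦ chainCount l r m k 1`. -/
theorem countCovers_outputsIn {n m : ℕ} {l r : Fin n → ℕ} (hlr : ∀ i, l i ≤ r i)
    (hl : ∀ i j, i < j → l i ≤ l j) (hrm : ∀ i, r i ≤ m) (hm : ∃ i, r i = m) {k : ℕ}
    (hk : k ≤ n) (hne : chainCount l r m k 1 ≠ 0) (hmin : ∀ j < k, chainCount l r m j 1 = 0) :
    ∃ t ≤ 21 + 33 * n + 9 * ∑ i, (r i + 1 - l i),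
      countCovers.OutputsIn (pairArray n l r) t (chainCount l r m k 1) := by
  suffices countCovers.Wp (fun s t => t ≤ 21 + 33 * n + 9 * ∑ i, (r i + 1 - l i) ∧
      s.reg 0 = chainCount l r m k 1) ⟨fun _ => 0, pairArray n l r⟩ 0 by
    obtain ⟨t, s, he, ht, hs⟩ := this
    exact ⟨t, by simpa using ht, s, he, hs⟩
  have hread : pairArray n l r 0 = n := by simp [pairArray]
  refine wp_block_cons (wp_const (wp_block_cons (wp_const (wp_block_cons (wp_load (wp_block_cons
    (wp_add (wp_block_cons (wp_add (wp_block_cons (wp_const (wp_block_cons (wp_maxLoop (n := n)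
    (m := m) (l := l) (r := r) hrm hm ?_ ?_ ?_ ?_ ?_ ?_ ?_ ?_ ?_)))))))))))))
  any_goals simp [hread]
  · omega
  intro s t hmem h₁ h₂ h₄ h₅ h₁₄ h₁₅ ht
  -- `K = n + 1` exceeds every possible cover size, so the minimum is never lost by truncation.
  refine wp_block_cons (wp_add (wp_block_cons (wp_add (wp_block_cons (wp_add (wp_block_cons
    (wp_add (wp_block_cons (wp_store (wp_block_cons (wp_add (wp_block_cons (wp_store
    (wp_block_cons (wp_sub (wp_block_cons (wp_tableLoop (n := n) (m := m) (K := n + 1) (l := l)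
    (r := r) hlr hl ?_ ?_ ?_ ?_ ?_ ?_ ?_ ?_)))))))))))))))))
  any_goals simp [h₁, h₂, h₄, h₅, h₁₄, h₁₅]
  · intro a ha
    rw [Function.update_of_ne (by omega), Function.update_of_ne (by omega), hmem]
  · intro q
    have haddr : m + m + 2 + (2 * n + 1) = 2 * n + 1 + 2 * (m + 1) := by omega
    rw [haddr]
    by_cases hq : q = m + 1
    · subst hq
      rw [Function.update_self, Function.update_of_ne (by omega), Function.update_self]
      -- The stored pair `(n + 1, 1)` means the value `1` at index `0`: the empty chain.
      exact ⟨le_rfl, fun k hk => by omega, fun _ => by simp [chainCountFrom]⟩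
    · have hzero : ∀ a, 2 * n < a → pairArray n l r a = 0 := by
        intro a ha
        rw [pairArray, if_neg (by omega), dif_neg (by omega)]
      rw [Function.update_of_ne (by omega), Function.update_of_ne (by omega),
        Function.update_of_ne (by omega), Function.update_of_ne (by omega), hmem,
        hzero _ (by omega), hzero _ (by omega)]
      convert IsLowestTerm.zero (n + 1) 0 using 1
      funext k
      exact chainCountFrom_top k fun h => absurd h hq
  intro s t' h₁ h₅ h₁₄ hT ht'
  refine wp_block_cons (wp_add (wp_block_cons (wp_add (wp_block_cons (wp_load
    (wp_block_nil ⟨?_, ?_⟩))))))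
  · rw [Finset.sum_add_distrib, ← Finset.mul_sum] at ht'
    simp at ht'
    omega
  · simpa [h₁, h₅, h₁₄] using (hT 1).eq_of_min (by omega) hne hmin

end RAM

/-! ### From convex bipartite graphs to intervals -/

section Graph

variable {V : Type*} {G : SimpleGraph V} {X Y : Finset V} {x : Fin X.card ≃ X} {y : Fin Y.card ≃ Y}

theorem neighborPositions_finite (G : SimpleGraph V) (y : Fin Y.card ≃ Y) (v : V) :
    (neighborPositions G y v).Finite := by
  refine (Set.finite_range fun j : Fin Y.card => (j : ℕ) + 1).subset ?_
  rintro p ⟨j, -, rfl⟩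
  exact ⟨j, rfl⟩

theorem neighborPositions_nonempty (hbip : G.IsBipartiteWith (X : Set V) (Y : Set V)) {v w : V}
    (hv : v ∈ X) (h : G.Adj v w) : (neighborPositions G y v).Nonempty := by
  have hw : w ∈ Y := by simpa using hbip.mem_of_mem_adj (by simpa using hv) h
  exact ⟨_, y.symm ⟨w, hw⟩, by simpa using h, rfl⟩

/-- In a convex ordering, a vertex is adjacent exactly to the positions between its leftmost and
its rightmost neighbour. -/
theorem adj_iff_leftPos_le (hy : IsConvexOrdering G X y) {v : V} (hv : v ∈ X)
    (hne : (neighborPositions G y v).Nonempty) (j : Fin Y.card) :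
    G.Adj v (y j) ↔ leftPos G y v ≤ j + 1 ∧ (j : ℕ) + 1 ≤ rightPos G y v := by
  constructor
  · intro h
    exact ⟨Nat.sInf_le ⟨j, h, rfl⟩,
      le_csSup (neighborPositions_finite G y v).bddAbove ⟨j, h, rfl⟩⟩
  · rintro ⟨h₁, h₂⟩
    obtain ⟨i, hi, hli⟩ := Nat.sInf_mem hne
    obtain ⟨k, hk, hrk⟩ := hne.csSup_mem (neighborPositions_finite G y v)
    rw [leftPos, hli] at h₁
    rw [rightPos, hrk] at h₂
    exact hy v hv i j k (Fin.le_def.2 (by omega)) (Fin.le_def.2 (by omega)) hi hk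

/-- The degrees of the vertices of `X` sum up to at most the number of edges. -/
theorem sum_rightPos_sub_leftPos_le (hbip : G.IsBipartiteWith (X : Set V) (Y : Set V))
    (hfin : G.edgeSet.Finite) (hy : IsConvexOrdering G X y)
    (hne : ∀ v ∈ X, (neighborPositions G y v).Nonempty) :
    ∑ i, (rightPos G y (x i) + 1 - leftPos G y (x i)) ≤ G.edgeSet.ncard := by
  classical
  have hcard : ∀ i, rightPos G y (x i) + 1 - leftPos G y (x i) =
      (Finset.univ.filter fun j => G.Adj (x i) (y j)).card := by
    intro i
    rw [← Nat.card_Icc, ← Finset.card_map ⟨fun j : Fin Y.card => (j : ℕ) + 1, fun a b h =>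
      Fin.ext (Nat.succ_injective h)⟩]
    congr 1
    ext p
    simp only [Finset.mem_Icc, Finset.mem_map, Finset.mem_filter, Finset.mem_univ, true_and,
      adj_iff_leftPos_le hy (x i).2 (hne _ (x i).2)]
    constructor
    · rintro ⟨h₁, h₂⟩
      obtain ⟨a, -, ha⟩ := Nat.sInf_mem (hne _ (x i).2)
      obtain ⟨b, -, hb⟩ := (hne _ (x i).2).csSup_mem (neighborPositions_finite G y (x i))
      change leftPos G y (x i) = _ at ha
      change rightPos G y (x i) = _ at hb
      have := b.2
      have hp : p - 1 + 1 = p := by omega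
      refine ⟨⟨p - 1, by omega⟩, ?_, hp⟩
      simp only [hp]
      exact ⟨h₁, h₂⟩
    · rintro ⟨j, h, rfl⟩
      exact h
  simp_rw [hcard]
  rw [← Finset.card_sigma, ← Set.ncard_coe_finset]
  refine Set.ncard_le_ncard_of_injOn (fun a => s((x a.1 : V), (y a.2 : V))) ?_ ?_ hfin
  · rintro ⟨i, j⟩ h
    simpa using h
  · rintro ⟨i, j⟩ - ⟨i', j'⟩ - h
    rcases Sym2.eq_iff.1 h with ⟨h₁, h₂⟩ | ⟨h₁, -⟩
    · have h₃ := x.injective (Subtype.ext h₁)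
      have h₄ := y.injective (Subtype.ext h₂)
      simp only at h₃ h₄
      rw [h₃, h₄]
    -- A swapped edge would put a vertex in both `X` and `Y`.
    · refine absurd (y j').2 fun hmem => Set.disjoint_left.1 hbip.disjoint (x i).2 ?_
      simp only at h₁
      simp [h₁]

/-- The ordering of `X` turns sets of indices into sets of vertices. -/
def indexEmbedding (x : Fin X.card ≃ X) : Fin X.card ↪ V :=
  x.toEmbedding.trans (Function.Embedding.subtype _)

theorem isRedDominating_map_iff (hy : IsConvexOrdering G X y)
    (hne : ∀ v ∈ X, (neighborPositions G y v).Nonempty) (hpos : ∀ v ∈ X, 1 ≤ leftPos G y v)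
    (S : Finset (Fin X.card)) :
    IsRedDominating G X Y (S.map (indexEmbedding x)) ↔
      CoversFrom (fun i => leftPos G y (x i)) (fun i => rightPos G y (x i)) Y.card 1 S := by
  constructor
  · rintro ⟨-, h⟩
    refine ⟨fun p hp hpm => ?_, fun i _ => hpos _ (x i).2⟩
    obtain ⟨v, hv, hadj⟩ := h (y ⟨p - 1, by omega⟩) (y _).2
    obtain ⟨i, hi, rfl⟩ := Finset.mem_map.1 hv
    have := (adj_iff_leftPos_le hy (x i).2 (hne _ (x i).2) _).1 hadj
    simp only [Nat.sub_add_cancel hp] at this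
    exact ⟨i, hi, this⟩
  · rintro ⟨h, -⟩
    refine ⟨fun v hv => ?_, fun w hw => ?_⟩
    · obtain ⟨i, -, rfl⟩ := Finset.mem_map.1 hv
      exact (x i).2
    · obtain ⟨j, hj⟩ := y.surjective ⟨w, hw⟩
      obtain ⟨i, hi, hij⟩ := h (j + 1) (by omega) (by omega)
      refine ⟨x i, Finset.mem_map_of_mem (indexEmbedding x) hi, ?_⟩
      have := (adj_iff_leftPos_le hy (x i).2 (hne _ (x i).2) j).2 hij
      rwa [hj] at this

theorem exists_map_indexEmbedding (x : Fin X.card ≃ X) {D : Finset V} (hD : D ⊆ X) :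
    ∃ S : Finset (Fin X.card), S.map (indexEmbedding x) = D := by
  classical
  refine ⟨Finset.univ.filter fun i => (x i : V) ∈ D, ?_⟩
  ext v
  simp only [Finset.mem_map, Finset.mem_filter, Finset.mem_univ, true_and]
  constructor
  · rintro ⟨i, hi, rfl⟩
    exact hi
  · intro hv
    refine ⟨x.symm ⟨v, hD hv⟩, ?_, ?_⟩ <;> simp [indexEmbedding, hv]

end Graph

/-! ### Assembly -/

theorem mainTheorem5 :
    ∃ (P : RAM.Program) (C : ℕ),
      ∀ (V : Type*) (G : SimpleGraph V) (X Y : Finset V),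
        G.Connected → G.IsBipartiteWith (X : Set V) (Y : Set V) → (∀ v : V, v ∈ X ∨ v ∈ Y) →
        X.Nonempty → Y.Nonempty →
        ∀ (x : Fin X.card ≃ X) (y : Fin Y.card ≃ Y), IsLexConvexOrdering G x y →
          ∃ t : ℕ, t ≤ C * (X.card + G.edgeSet.ncard) ∧
            P.OutputsIn (neighborhoodArray G x y) t (mcrdSets G X Y).ncard := by
  classical
  -- `54 = 21 + 33`: the constant overhead is absorbed because `X` is non-empty.
  refine ⟨RAM.countCovers, 54, ?_⟩
  intro V G X Y hconn hbip hV hX hY x y ⟨hy, hlex⟩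
  have hVfin : Finite V := by
    refine Set.finite_univ_iff.1 ((X ∪ Y).finite_toSet.subset fun v _ => ?_)
    simpa using hV v
  have hdisj : ∀ v ∈ X, v ∉ Y := fun v h₁ h₂ =>
    Set.disjoint_left.1 hbip.disjoint (Finset.mem_coe.2 h₁) (Finset.mem_coe.2 h₂)
  have hnt : Nontrivial V := by
    obtain ⟨a, ha⟩ := hX
    obtain ⟨b, hb⟩ := hY
    exact ⟨a, b, by rintro rfl; exact hdisj a ha hb⟩
  -- Connectedness with at least two vertices excludes isolated vertices, whose end positions would
  -- be junk values.
  have hne : ∀ v ∈ X, (neighborPositions G y v).Nonempty := by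
    intro v hv
    obtain ⟨w, hw⟩ := hconn.preconnected.exists_adj_of_nontrivial v
    exact neighborPositions_nonempty hbip hv hw
  have hpos : ∀ v ∈ X, 1 ≤ leftPos G y v := by
    intro v hv
    obtain ⟨i, -, hi⟩ := Nat.sInf_mem (hne v hv)
    rw [leftPos, hi]
    omega
  have hle : ∀ v ∈ X, leftPos G y v ≤ rightPos G y v := fun v hv =>
    Nat.sInf_le ((hne v hv).csSup_mem (neighborPositions_finite G y v))
  have hright : ∀ v ∈ X, rightPos G y v ≤ Y.card := by
    intro v hv
    obtain ⟨i, -, hi⟩ := (hne v hv).csSup_mem (neighborPositions_finite G y v)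
    rw [rightPos, hi]
    omega
  set l : Fin X.card → ℕ := fun i => leftPos G y (x i) with hl
  set r : Fin X.card → ℕ := fun i => rightPos G y (x i) with hr
  have hlr : ∀ i, l i ≤ r i := fun i => hle _ (x i).2
  have hrm : ∀ i, r i ≤ Y.card := fun i => hright _ (x i).2
  have hmono : ∀ i j, i < j → l i ≤ l j := by
    intro i j hij
    rcases hlex i j hij with h | ⟨h, -⟩
    · exact h.le
    · exact h.le
  have hdom (S : Finset (Fin X.card)) :
      IsRedDominating G X Y (S.map (indexEmbedding x)) ↔ CoversFrom l r Y.card 1 S :=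
    isRedDominating_map_iff hy hne hpos S
  have huniv : CoversFrom l r Y.card 1 Finset.univ := by
    rw [← hdom]
    refine ⟨fun v hv => ?_, fun w hw => ?_⟩
    · obtain ⟨i, -, rfl⟩ := Finset.mem_map.1 hv
      exact (x i).2
    · obtain ⟨v, hv⟩ := hconn.preconnected.exists_adj_of_nontrivial w
      have hvX : v ∈ X := by simpa using hbip.symm.mem_of_mem_adj (by simpa using hw) hv
      refine ⟨v, Finset.mem_map.2 ⟨x.symm ⟨v, hvX⟩, Finset.mem_univ _, ?_⟩, hv.symm⟩
      simp [indexEmbedding]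
  have hcardY : 1 ≤ Y.card := Finset.card_pos.2 hY
  have hm : ∃ i, r i = Y.card := by
    obtain ⟨i, -, -, hi⟩ := huniv.1 Y.card hcardY le_rfl
    exact ⟨i, le_antisymm (hrm i) hi⟩
  obtain ⟨S₀, hS₀, hmin⟩ := Finset.exists_min_image
    (Finset.univ.filter fun S => CoversFrom l r Y.card 1 S) Finset.card ⟨_, by simpa using huniv⟩
  simp only [Finset.mem_filter, Finset.mem_univ, true_and] at hS₀ hmin
  have hcount := card_coversFrom_eq_chainCount hlr hrm S₀.card 1 (by omega) hmin
  have hmcrd : (mcrdSets G X Y).ncard = chainCount l r Y.card S₀.card 1 := by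
    rw [← hcount, ← Finset.card_map (Finset.mapEmbedding (indexEmbedding x)).toEmbedding,
      ← Set.ncard_coe_finset]
    congr 1
    ext D
    simp only [Finset.coe_map, Finset.coe_filter, Finset.mem_univ, true_and, Set.mem_image,
      RelEmbedding.coe_toEmbedding, Finset.mapEmbedding_apply, Set.mem_ofPred_eq]
    constructor
    · rintro ⟨hD, hDmin⟩
      obtain ⟨S, rfl⟩ := exists_map_indexEmbedding x hD.1
      have hS := (hdom S).1 hD
      refine ⟨S, ⟨hS, le_antisymm ?_ (hmin S hS)⟩, rfl⟩
      simpa using hDmin _ ((hdom S₀).2 hS₀)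
    · rintro ⟨S, ⟨hS, hc⟩, rfl⟩
      refine ⟨(hdom S).2 hS, fun D' hD' => ?_⟩
      obtain ⟨S', rfl⟩ := exists_map_indexEmbedding x hD'.1
      simpa [hc] using hmin S' ((hdom S').1 hD')
  obtain ⟨t, ht, hout⟩ := RAM.countCovers_outputsIn (k := S₀.card) hlr hmono hrm hm
    (by simpa using Finset.card_le_univ S₀)
    (by
      rw [← hcount]
      exact Finset.card_ne_zero_of_mem (Finset.mem_filter.2 ⟨Finset.mem_univ _, hS₀, rfl⟩))
    (by
      intro j hj
      by_contra h
      obtain ⟨S, hS, hc⟩ := exists_coversFrom_of_chainCount_ne_zero j 1 h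
      have := hmin S hS
      omega)
  refine ⟨t, ?_, hmcrd ▸ hout⟩
  have hedges : ∑ i, (r i + 1 - l i) ≤ G.edgeSet.ncard :=
    sum_rightPos_sub_leftPos_le hbip (Set.toFinite _) hy hne
  have := Finset.card_pos.2 hX
  omega
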